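/- **Theorem (Ahlfors–Beurling).** Let $S^2=\mathbb{C}\cup\{\infty\}$ be the Riemann sphere and $\Sigma=S^2\setminus\{0,1,\infty\}$ the thrice-punctured sphere, with the complex structure inherited from $S^2$. Let $M$ be a compact (connected, Hausdorff) Riemann surface, let $U\subset M$ be an open subset, and let $j:\Sigma\to U$ be a conformal isomorphism, i.e. a biholomorphic map. Then there is a biholomorphic map $\Phi:M\to S^2$ such that $\Phi(j(p))=p$ for every $p\in\Sigma$. In other words, $M$ is conformally the Riemann sphere, and under this identification $\Sigma\hookrightarrow M$ is the standard embedding $\Sigma\hookrightarrow S^2$. -/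

import Mathlib

open Topology Manifold Filter
open scoped ContDiff

/-- The underlying topological space of the Riemann sphere `ℂ ∪ {∞}`. -/
abbrev RiemannSphere : Type := OnePoint ℂ

namespace RiemannSphere

/-- The inversion `z ↦ 1 / z` of the sphere, interchanging `0` and `∞`. -/
noncomputable def invFun : RiemannSphere → RiemannSphere
  | OnePoint.infty => ((0 : ℂ) : RiemannSphere)
  | OnePoint.some z => if z = 0 then OnePoint.infty else ((z⁻¹ : ℂ) : RiemannSphere)

theorem invFun_infty : invFun OnePoint.infty = ((0 : ℂ) : RiemannSphere) := rfl

theorem invFun_coe (z : ℂ) : invFun (z : RiemannSphere) =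
    if z = 0 then OnePoint.infty else ((z⁻¹ : ℂ) : RiemannSphere) := rfl

theorem invFun_zero : invFun ((0 : ℂ) : RiemannSphere) = OnePoint.infty := by
  simp [invFun_coe]

theorem invFun_coe_of_ne {z : ℂ} (hz : z ≠ 0) :
    invFun (z : RiemannSphere) = ((z⁻¹ : ℂ) : RiemannSphere) := by
  simp [invFun_coe, hz]

theorem invFun_invFun (p : RiemannSphere) : invFun (invFun p) = p := by
  induction p using OnePoint.rec with
  | infty => rw [invFun_infty, invFun_zero]
  | coe z =>
    by_cases hz : z = 0
    · subst hz; rw [invFun_zero, invFun_infty]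
    · rw [invFun_coe_of_ne hz, invFun_coe_of_ne (inv_ne_zero hz), inv_inv]

theorem continuous_invFun : Continuous invFun := by
  rw [continuous_iff_continuousAt]
  intro p
  induction p using OnePoint.rec with
  | infty =>
    rw [OnePoint.continuousAt_infty', invFun_infty, Filter.coclosedCompact_eq_cocompact,
      ← Metric.cobounded_eq_cocompact]
    have h : Tendsto (fun z : ℂ => ((z⁻¹ : ℂ) : RiemannSphere)) (Bornology.cobounded ℂ)
        (𝓝 ((0 : ℂ) : RiemannSphere)) :=
      (OnePoint.continuous_coe.tendsto (0 : ℂ)).comp tendsto_inv₀_cobounded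
    refine h.congr' ?_
    filter_upwards [Bornology.eventually_ne_cobounded (0 : ℂ)] with z hz
    exact (invFun_coe_of_ne hz).symm
  | coe z =>
    rw [OnePoint.continuousAt_coe]
    by_cases hz : z = 0
    · subst hz
      rw [continuousAt_iff_punctured_nhds, Function.comp_apply, invFun_zero]
      have h : Tendsto (fun z : ℂ => ((z⁻¹ : ℂ) : RiemannSphere)) (𝓝[≠] 0)
          (𝓝 (OnePoint.infty : RiemannSphere)) := by
        refine OnePoint.tendsto_coe_infty.comp ?_
        rw [Filter.coclosedCompact_eq_cocompact, ← Metric.cobounded_eq_cocompact]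
        exact tendsto_inv₀_nhdsNE_zero
      refine h.congr' ?_
      filter_upwards [self_mem_nhdsWithin] with z hz
      exact (invFun_coe_of_ne hz).symm
    · have h : ContinuousAt (fun z : ℂ => ((z⁻¹ : ℂ) : RiemannSphere)) z :=
        OnePoint.continuous_coe.continuousAt.comp (continuousAt_inv₀ hz)
      refine h.congr ?_
      filter_upwards [isOpen_ne.mem_nhds hz] with w hw
      exact (invFun_coe_of_ne hw).symm

/-- The inversion as a homeomorphism of the sphere. -/
noncomputable def inversion : RiemannSphere ≃ₜ RiemannSphere where
  toFun := invFun
  invFun := invFun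
  left_inv := invFun_invFun
  right_inv := invFun_invFun
  continuous_toFun := continuous_invFun
  continuous_invFun := continuous_invFun

/-- The affine chart `z` on the complement of `∞`. -/
noncomputable def chartZ : OpenPartialHomeomorph RiemannSphere ℂ :=
  (OnePoint.isOpenEmbedding_coe.toOpenPartialHomeomorph ((↑) : ℂ → RiemannSphere)).symm

/-- The chart `1 / z` on the complement of `0`, vanishing at `∞`. -/
noncomputable def chartW : OpenPartialHomeomorph RiemannSphere ℂ :=
  inversion.toOpenPartialHomeomorph.trans chartZ

theorem chartZ_source : chartZ.source = Set.range ((↑) : ℂ → RiemannSphere) := by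
  simp [chartZ]

theorem chartZ_target : chartZ.target = Set.univ := by
  simp [chartZ]

theorem chartZ_coe (z : ℂ) : chartZ (z : RiemannSphere) = z :=
  (OnePoint.isOpenEmbedding_coe.toOpenPartialHomeomorph
    ((↑) : ℂ → RiemannSphere)).left_inv (Set.mem_univ z)

theorem chartZ_symm_apply (z : ℂ) : chartZ.symm z = (z : RiemannSphere) := rfl

theorem chartW_apply (p : RiemannSphere) : chartW p = chartZ (invFun p) := rfl

theorem chartW_symm_apply (z : ℂ) : chartW.symm z = invFun (z : RiemannSphere) := rfl

theorem mem_chartW_source (p : RiemannSphere) :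
    p ∈ chartW.source ↔ invFun p ∈ chartZ.source := by
  simp [chartW, inversion]

/-- The complex structure of the Riemann sphere: the atlas consists of `z` and `1 / z`. -/
noncomputable instance instChartedSpace : ChartedSpace ℂ RiemannSphere where
  atlas := {chartZ, chartW}
  chartAt
    | OnePoint.infty => chartW
    | OnePoint.some _ => chartZ
  mem_chart_source p := by
    induction p using OnePoint.rec with
    | infty =>
      change OnePoint.infty ∈ chartW.source
      rw [mem_chartW_source, invFun_infty, chartZ_source]
      exact Set.mem_range_self _
    | coe z =>
      change (z : RiemannSphere) ∈ chartZ.source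
      rw [chartZ_source]
      exact Set.mem_range_self _
  chart_mem_atlas p := by
    induction p using OnePoint.rec with
    | infty => exact Set.mem_insert_of_mem _ rfl
    | coe z => exact Set.mem_insert _ _

/-- The transition maps are the identity and `z ↦ 1 / z` on `ℂ \ {0}`, so they are holomorphic. -/
instance instIsManifold : IsManifold 𝓘(ℂ) ω RiemannSphere := by
  have hinv : ∀ z : ℂ, invFun (z : RiemannSphere) ∈ chartZ.source → z ≠ 0 := by
    rintro z hz rfl
    rw [invFun_zero, chartZ_source] at hz
    obtain ⟨w, hw⟩ := hz
    exact OnePoint.coe_ne_infty w hw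
  have key : ∀ z : ℂ, z ≠ 0 → chartZ (invFun (z : RiemannSphere)) = z⁻¹ := by
    intro z hz
    rw [invFun_coe_of_ne hz, chartZ_coe]
  have hcd : ContDiffOn ℂ ω (fun z : ℂ => z⁻¹) {z : ℂ | z ≠ 0} :=
    fun z hz => (contDiffAt_inv ℂ hz).contDiffWithinAt
  refine isManifold_of_contDiffOn 𝓘(ℂ) ω RiemannSphere ?_
  rintro e e' he he'
  simp only [modelWithCornersSelf_coe, modelWithCornersSelf_coe_symm, Function.id_comp,
    Function.comp_id, Set.preimage_id, Set.range_id, Set.inter_univ]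
  rcases he with rfl | he <;> rcases he' with rfl | he'
  · refine contDiffOn_id.congr fun z _ => ?_
    exact chartZ_coe z
  · rw [Set.mem_singleton_iff] at he'
    subst he'
    have hsub : (chartZ.symm.trans chartW).source ⊆ {z : ℂ | z ≠ 0} := by
      intro z hz
      rw [OpenPartialHomeomorph.trans_source] at hz
      exact hinv z ((mem_chartW_source _).1 hz.2)
    exact (hcd.mono hsub).congr fun z hz => key z (hsub hz)
  · rw [Set.mem_singleton_iff] at he
    subst he
    have hsub : (chartW.symm.trans chartZ).source ⊆ {z : ℂ | z ≠ 0} := by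
      intro z hz
      rw [OpenPartialHomeomorph.trans_source] at hz
      exact hinv z hz.2
    exact (hcd.mono hsub).congr fun z hz => key z (hsub hz)
  · rw [Set.mem_singleton_iff] at he he'
    subst he he'
    refine contDiffOn_id.congr fun z _ => ?_
    change chartZ (invFun (invFun (z : RiemannSphere))) = z
    rw [invFun_invFun, chartZ_coe]

end RiemannSphere

/-- The thrice-punctured sphere `Σ = S² \ {0, 1, ∞}`, an open subset of the Riemann sphere
(and as such a Riemann surface). -/
def thricePuncturedSphere : TopologicalSpace.Opens RiemannSphere where
  carrier := {((0 : ℂ) : RiemannSphere), ((1 : ℂ) : RiemannSphere), OnePoint.infty}ᶜ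
  is_open' := (Set.toFinite _).isClosed.isOpen_compl

/-!
The theorem is proved for every compact Riemann surface `X` in place of the sphere, every open
`V ⊆ X` with finite complement and every biholomorphic map `j` of `V` onto an open subset of the
compact connected surface `M`: such a `j` extends to a biholomorphic map `X → M`
(`Diffeomorph.exists_extension_of_finite_compl`). The complement of `j V` in `M` is not assumed to
be small, so the main point is that `j` has a limit at each puncture.

*Small circles* (`exists_point_small_circles`). Let `z` be a coordinate that vanishes at a
puncture. In the logarithmic coordinate `w` with `z = exp w`, a neighbourhood of the puncture is
the half strip `Re w < 0`, `-π < Im w ≤ π`, on which `h = j ∘ exp` is injective. Finitely many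
cut-off coordinate functions `G` on `M`, each supported in a compact part of a chart, separate the
points of `M`. Because `h` is injective and holomorphic, the Dirichlet integral of `G ∘ h` over
the half strip is at most a constant times the area of a compact subset of the plane, hence finite
(`lintegral_enorm_fderiv_chartExtend_comp_ne_top`). By Tonelli's theorem, some vertical segments
arbitrarily far to the left carry arbitrarily little of it, so the functions `G` oscillate little
on the corresponding small circles (`exists_segment_oscillation_le`). By compactness of `M`,
arbitrarily small circles are mapped into any given neighbourhood of some point `q`.

*The limit* (`tendsto_of_small_circles`). The image of the annulus between two such circles has its
frontier near `q`. A connectedness argument with a chart disc `W` about `q` shows that this image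
lies in `W`, or else together with `W` exhausts `M`; injectivity of `j` excludes the latter.

*The extension.* The extended map is continuous, hence holomorphic by Riemann's theorem on
removable singularities (`contMDiff_of_continuous_of_finite_compl`). By the open mapping theorem it
is open, hence surjective, and two points with the same image would contradict injectivity off the
punctures (`ContMDiff.bijective_of_injOn_compl_finite`). Its inverse is continuous, and holomorphic
off a finite set, hence holomorphic by the removable singularity theorem again.
-/

open Topology Manifold Filter
open scoped ContDiff

/-! ### Holomorphic maps between Riemann surfaces -/

section RiemannSurface

variable {X Y : Type*} [TopologicalSpace X] [ChartedSpace ℂ X]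
  [TopologicalSpace Y] [ChartedSpace ℂ Y]

theorem contMDiffAt_iff_chart_expression {F : X → Y} {x : X} :
    ContMDiffAt 𝓘(ℂ) 𝓘(ℂ) ω F x ↔ ContinuousAt F x ∧
      ContDiffAt ℂ ω (chartAt ℂ (F x) ∘ F ∘ (chartAt ℂ x).symm) (chartAt ℂ x x) := by
  rw [contMDiffAt_iff]
  simp [contDiffWithinAt_univ]

/-- Riemann's removable singularity theorem for maps of Riemann surfaces: a continuous map that is
holomorphic off a finite set is holomorphic. -/
theorem contMDiff_of_continuous_of_finite_compl [T1Space X] [IsManifold 𝓘(ℂ) ω X]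
    [IsManifold 𝓘(ℂ) ω Y] {F : X → Y} (hF : Continuous F) {s : Set X} (hs : s.Finite)
    (h : ∀ x ∉ s, ContMDiffAt 𝓘(ℂ) 𝓘(ℂ) ω F x) : ContMDiff 𝓘(ℂ) 𝓘(ℂ) ω F := by
  intro x
  refine contMDiffAt_iff_chart_expression.2 ⟨hF.continuousAt, ?_⟩
  set φ := chartAt ℂ x
  set ψ := chartAt ℂ (F x)
  have hx : x ∈ φ.source := mem_chart_source ℂ x
  have hFx : F x ∈ ψ.source := mem_chart_source ℂ (F x)
  set V : Set ℂ := φ.target ∩ φ.symm ⁻¹' (F ⁻¹' ψ.source ∩ (s \ {x})ᶜ)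
  have hVo : IsOpen V := φ.symm.isOpen_inter_preimage
    ((ψ.open_source.preimage hF).inter hs.sdiff.isClosed.isOpen_compl)
  have hcV : φ x ∈ V := ⟨φ.map_source hx, by simp [φ.left_inv hx, hFx]⟩
  have hcont : ContinuousAt (ψ ∘ F ∘ φ.symm) (φ x) := by
    have h1 : ContinuousAt φ.symm (φ x) := φ.symm.continuousAt (φ.map_source hx)
    have h2 : ContinuousAt ψ (F (φ.symm (φ x))) := by
      rw [φ.left_inv hx]; exact ψ.continuousAt hFx
    have h3 : ContinuousAt (F ∘ φ.symm) (φ x) := hF.continuousAt.comp h1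
    exact ContinuousAt.comp (g := ψ) h2 h3
  have hdiff : DifferentiableOn ℂ (ψ ∘ F ∘ φ.symm) (V \ {φ x}) := by
    rintro z ⟨⟨hzt, hzF, hzs⟩, hzx⟩
    have hne : φ.symm z ≠ x := by
      rintro hzx'
      exact hzx (by rw [Set.mem_singleton_iff, ← hzx', φ.right_inv hzt])
    have hns : φ.symm z ∉ s := fun hzs' => hzs ⟨hzs', hne⟩
    have h1 : ContMDiffAt 𝓘(ℂ) 𝓘(ℂ) ω φ.symm z :=
      contMDiffOn_chart_symm.contMDiffAt (φ.open_target.mem_nhds hzt)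
    have h2 : ContMDiffAt 𝓘(ℂ) 𝓘(ℂ) ω ψ (F (φ.symm z)) :=
      contMDiffOn_chart.contMDiffAt (ψ.open_source.mem_nhds hzF)
    have h3 : ContMDiffAt 𝓘(ℂ) 𝓘(ℂ) ω (ψ ∘ F ∘ φ.symm) z := h2.comp z ((h _ hns).comp z h1)
    exact (h3.contDiffAt.differentiableAt (by simp)).differentiableWithinAt
  have hV := (Complex.differentiableOn_compl_singleton_and_continuousAt_iff
    (hVo.mem_nhds hcV)).1 ⟨hdiff, hcont⟩
  exact (hV.analyticAt (hVo.mem_nhds hcV)).contDiffAt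

/-- The open mapping theorem for maps of Riemann surfaces, at one point. -/
theorem ContMDiffAt.nhds_le_map_nhds_of_not_eventually_const {F : X → Y} {x : X}
    (hF : ContMDiffAt 𝓘(ℂ) 𝓘(ℂ) ω F x) (hc : ¬ ∀ᶠ y in 𝓝 x, F y = F x) :
    𝓝 (F x) ≤ map F (𝓝 x) := by
  obtain ⟨hcont, hG⟩ := contMDiffAt_iff_chart_expression.1 hF
  set φ := chartAt ℂ x
  set ψ := chartAt ℂ (F x)
  have hx : x ∈ φ.source := mem_chart_source ℂ x
  have hFx : F x ∈ ψ.source := mem_chart_source ℂ (F x)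
  have hev : ∀ᶠ y in 𝓝 x, y ∈ φ.source ∧ F y ∈ ψ.source :=
    inter_mem (φ.open_source.mem_nhds hx) (hcont (ψ.open_source.mem_nhds hFx))
  have hmap : map φ.symm (𝓝 (φ x)) = 𝓝 x := by
    rw [φ.symm.map_nhds_eq (φ.map_source hx), φ.left_inv hx]
  rcases hG.analyticAt.eventually_constant_or_nhds_le_map_nhds with h | h
  · refine absurd ?_ hc
    have h' := (φ.continuousAt hx).eventually h
    filter_upwards [h', hev] with y hy ⟨hy1, hy2⟩
    simp only [Function.comp_apply, φ.left_inv hy1, φ.left_inv hx] at hy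
    exact ψ.injOn hy2 hFx hy
  · have hGx : (ψ ∘ F ∘ φ.symm) (φ x) = ψ (F x) := by simp [φ.left_inv hx]
    rw [hGx] at h
    calc 𝓝 (F x) = map ψ.symm (𝓝 (ψ (F x))) := by
          rw [ψ.symm.map_nhds_eq (ψ.map_source hFx), ψ.left_inv hFx]
      _ ≤ map ψ.symm (map (ψ ∘ F ∘ φ.symm) (𝓝 (φ x))) := map_mono h
      _ = map (ψ.symm ∘ ψ ∘ F) (𝓝 x) := by rw [← hmap, map_map, map_map]; rfl
      _ = map F (𝓝 x) := map_congr <| hev.mono fun y hy => ψ.left_inv hy.2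

theorem nhdsNE_neBot_of_chartedSpace_complex (x : X) : (𝓝[≠] x).NeBot := by
  set φ := chartAt ℂ x
  have hx : x ∈ φ.source := mem_chart_source ℂ x
  rw [nhdsWithin_neBot]
  intro t ht
  have h1 : φ.symm ⁻¹' t ∩ φ.target ∈ 𝓝 (φ x) :=
    inter_mem ((φ.tendsto_symm hx) ht) (φ.open_target.mem_nhds (φ.map_source hx))
  obtain ⟨z, hz, hzx⟩ := (nhdsWithin_neBot.1 (inferInstance : (𝓝[≠] (φ x)).NeBot)) h1
  refine ⟨φ.symm z, hz.1, ?_⟩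
  rintro h
  exact hzx (by rw [Set.mem_singleton_iff, ← (h : φ.symm z = x), φ.right_inv hz.2])

/-- A holomorphic map from a compact Riemann surface to a connected one that is injective off a
finite set is bijective. -/
theorem ContMDiff.bijective_of_injOn_compl_finite [CompactSpace X] [T2Space X] [Nonempty X]
    [T2Space Y] [ConnectedSpace Y] {F : X → Y} (hF : ContMDiff 𝓘(ℂ) 𝓘(ℂ) ω F)
    {s : Set X} (hs : s.Finite) (hinj : Set.InjOn F sᶜ) : Function.Bijective F := by
  have hXY : IsOpenMap F := by
    refine isOpenMap_iff_nhds_le.2 fun x => (hF x).nhds_le_map_nhds_of_not_eventually_const ?_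
    intro hc
    -- near `x` there are two distinct points outside `s`
    have := nhdsNE_neBot_of_chartedSpace_complex x
    have hinf : ({y | F y = F x} \ s).Infinite := (infinite_of_mem_nhds x hc).sdiff hs
    obtain ⟨a, ha⟩ := hinf.nonempty
    obtain ⟨b, hb, hba⟩ := (hinf.sdiff (Set.finite_singleton a)).nonempty
    exact hba (hinj hb.2 ha.2 (hb.1.trans ha.1.symm))
  refine ⟨fun x y hxy => ?_, ?_⟩
  · by_contra hne
    obtain ⟨A, B, hA, hB, hxA, hyB, hAB⟩ := t2_separation hne
    have hO : F '' A ∩ F '' B ∈ 𝓝 (F x) := inter_mem ((hXY A hA).mem_nhds ⟨x, hxA, rfl⟩)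
      ((hXY B hB).mem_nhds ⟨y, hyB, hxy.symm⟩)
    have := nhdsNE_neBot_of_chartedSpace_complex (F x)
    obtain ⟨q, ⟨⟨a, ha, haq⟩, ⟨b, hb, hbq⟩⟩, hqs⟩ :=
      ((infinite_of_mem_nhds (F x) hO).sdiff (hs.image F)).nonempty
    have has : a ∈ sᶜ := fun h => hqs ⟨a, h, haq⟩
    have hbs : b ∈ sᶜ := fun h => hqs ⟨b, h, hbq⟩
    exact Set.disjoint_left.1 hAB ha (hinj has hbs (haq.trans hbq.symm) ▸ hb)
  · have hr : IsClopen (Set.range F) :=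
      ⟨(isCompact_range hF.continuous).isClosed, hXY.isOpen_range⟩
    exact Set.range_eq_univ.1 (hr.eq_univ (Set.range_nonempty F))

end RiemannSurface

/-! ### The length-area estimate -/

/-- The half strip `Re w < 0`, `-π < Im w ≤ π`, which the exponential maps bijectively onto the
punctured unit disc. -/
def logStrip : Set ℂ := {w | w.re < 0 ∧ w.im ∈ Set.Ioc (-Real.pi) Real.pi}

theorem measurableSet_logStrip : MeasurableSet logStrip :=
  (measurableSet_Iio.preimage Complex.measurable_re).inter
    (measurableSet_Ioc.preimage Complex.measurable_im)

open MeasureTheory in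
/-- If `F` is integrable on the half strip, its integral over some vertical segment arbitrarily far
to the left is as small as desired: otherwise Tonelli's theorem would make the integral infinite. -/
theorem exists_lintegral_segment_lt {F : ℂ → ENNReal} (hF : Measurable F)
    (hfin : ∫⁻ w in logStrip, F w ≠ ⊤) {δ : ENNReal} (hδ : δ ≠ 0) {R : ℝ} (hR : R ≤ 0) :
    ∃ s < R, ∫⁻ t in Set.Ioc (-Real.pi) Real.pi, F (s + t * Complex.I) < δ := by
  by_contra! hcon
  apply hfin
  have hpre : Complex.measurableEquivRealProd ⁻¹'
      (Set.Iio (0 : ℝ) ×ˢ Set.Ioc (-Real.pi) Real.pi) = logStrip := rfl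
  have hF' : Measurable (fun p : ℝ × ℝ => F (p.1 + p.2 * Complex.I)) := by fun_prop
  have h1 : ∫⁻ w in logStrip, F w =
      ∫⁻ s in Set.Iio (0 : ℝ), ∫⁻ t in Set.Ioc (-Real.pi) Real.pi, F (s + t * Complex.I) := by
    have h2 := Complex.volume_preserving_equiv_real_prod.setLIntegral_comp_preimage
      (measurableSet_Iio.prod measurableSet_Ioc) (s := Set.Iio (0 : ℝ) ×ˢ
        Set.Ioc (-Real.pi) Real.pi) hF'
    rw [hpre] at h2
    simp only [Complex.measurableEquivRealProd_apply, Complex.re_add_im] at h2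
    rw [h2, Measure.volume_eq_prod, ← Measure.prod_restrict, lintegral_prod _ hF'.aemeasurable]
  rw [h1]
  refine top_le_iff.1 ?_
  calc (⊤ : ENNReal) = ∫⁻ _ in Set.Iio R, δ := by
        simp [ENNReal.mul_top hδ]
    _ ≤ ∫⁻ s in Set.Iio R, ∫⁻ t in Set.Ioc (-Real.pi) Real.pi, F (s + t * Complex.I) :=
        setLIntegral_mono' measurableSet_Iio fun s hs => hcon s hs
    _ ≤ _ := lintegral_mono_set (Set.Iio_subset_Iio hR)

open MeasureTheory in
/-- A curve with small energy has small oscillation. -/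
theorem enorm_sub_le_of_lintegral_enorm_deriv_sq {E : Type*} [NormedAddCommGroup E]
    [NormedSpace ℝ E] [CompleteSpace E] {v : ℝ → E} {a b t t' : ℝ}
    (hv : ContDiffOn ℝ 1 v (Set.Icc a b)) (ht : t ∈ Set.Icc a b) (ht' : t' ∈ Set.Icc a b)
    {η : NNReal} (hη : η ≠ 0) :
    ‖v t - v t'‖ₑ ≤ η * ENNReal.ofReal (b - a) + (η : ENNReal)⁻¹ *
      ∫⁻ x in Set.Ioc a b, ‖deriv v x‖ₑ ^ 2 := by
  wlog htt : t' ≤ t generalizing t t'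
  · rw [enorm_sub_rev]
    exact this ht' ht (le_of_not_ge htt)
  -- the inequality `x ≤ η + x² / η`
  have key : ∀ x : ENNReal, x ≤ η + (η : ENNReal)⁻¹ * x ^ 2 := by
    intro x
    rcases le_total x η with h | h
    · exact h.trans le_self_add
    · refine le_trans ?_ le_add_self
      calc x = (η : ENNReal)⁻¹ * η * x := by
            rw [ENNReal.inv_mul_cancel (by simpa using hη) ENNReal.coe_ne_top, one_mul]
        _ ≤ (η : ENNReal)⁻¹ * x * x := by gcongr
        _ = _ := by ring
  calc ‖v t - v t'‖ₑ ≤ ∫⁻ x in Set.Icc t' t, ‖deriv v x‖ₑ :=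
        enorm_sub_le_lintegral_deriv_of_contDiffOn_Icc
          (hv.mono (Set.Icc_subset_Icc ht'.1 ht.2)) htt
    _ ≤ ∫⁻ x in Set.Icc a b, ‖deriv v x‖ₑ :=
        lintegral_mono_set (Set.Icc_subset_Icc ht'.1 ht.2)
    _ = ∫⁻ x in Set.Ioc a b, ‖deriv v x‖ₑ := by rw [restrict_Ioc_eq_restrict_Icc]
    _ ≤ ∫⁻ x in Set.Ioc a b, (η + (η : ENNReal)⁻¹ * ‖deriv v x‖ₑ ^ 2) :=
        lintegral_mono fun x => key _
    _ = _ := by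
        rw [lintegral_add_left measurable_const, lintegral_const_mul' _ _ (by simpa using hη)]
        simp

open MeasureTheory in
/-- The length-area principle: finitely many functions of finite Dirichlet integral on the half
strip have simultaneously small oscillation on some vertical segment arbitrarily far to the
left. -/
theorem exists_segment_oscillation_le {E ι : Type*} [Fintype ι] [NormedAddCommGroup E]
    [NormedSpace ℝ E] [CompleteSpace E] {u : ι → ℂ → E}
    (hu : ∀ i, ContDiffOn ℝ 1 (u i) {w | w.re < 0})
    (hfin : ∀ i, ∫⁻ w in logStrip, ‖fderiv ℝ (u i) w‖ₑ ^ 2 ≠ ⊤) {ε : ℝ} (hε : 0 < ε) {R : ℝ}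
    (hR : R ≤ 0) :
    ∃ s < R, ∀ i, ∀ t ∈ Set.Icc (-Real.pi) Real.pi, ∀ t' ∈ Set.Icc (-Real.pi) Real.pi,
      ‖u i (s + t * Complex.I) - u i (s + t' * Complex.I)‖ ≤ ε := by
  have hpi := Real.pi_pos
  set η : NNReal := (ε / (4 * Real.pi)).toNNReal with hηdef
  have hη0 : 0 < ε / (4 * Real.pi) := by positivity
  have hη : η ≠ 0 := by simpa [hηdef] using hη0
  have hmeas : ∀ i, Measurable fun w => ‖fderiv ℝ (u i) w‖ₑ ^ 2 := fun i =>
    ((measurable_fderiv ℝ (u i)).enorm).pow_const 2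
  obtain ⟨s, hsR, hs⟩ := exists_lintegral_segment_lt
    (F := fun w => ∑ i, ‖fderiv ℝ (u i) w‖ₑ ^ 2) (Finset.measurable_fun_sum _ fun i _ => hmeas i)
    (by
      rw [lintegral_finsetSum _ fun i _ => hmeas i]
      exact ENNReal.sum_ne_top.2 fun i _ => hfin i)
    (δ := η * ENNReal.ofReal (ε / 2)) (by simpa [hη] using hε) hR
  refine ⟨s, hsR, fun i t ht t' ht' => ?_⟩
  have hs0 : s < 0 := hsR.trans_le hR
  have hopen : IsOpen {w : ℂ | w.re < 0} := isOpen_lt Complex.continuous_re continuous_const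
  have hmem : ∀ x : ℝ, (s + x * Complex.I : ℂ) ∈ {w : ℂ | w.re < 0} := fun x => by simpa using hs0
  have hline : ∀ x : ℝ, HasDerivAt (fun y : ℝ => (s + y * Complex.I : ℂ)) Complex.I x := fun x => by
    simpa using ((hasDerivAt_id x).ofReal_comp.mul_const Complex.I).const_add (s : ℂ)
  have hC : ContDiff ℝ 1 (fun x : ℝ => u i (s + x * Complex.I)) := by
    rw [contDiff_iff_contDiffAt]
    intro x
    have h1 : ContDiffAt ℝ 1 (fun y : ℝ => (s + y * Complex.I : ℂ)) x := by
      have : ContDiff ℝ 1 (fun y : ℝ => (y : ℂ)) := Complex.ofRealCLM.contDiff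
      exact (contDiff_const.add (this.mul contDiff_const)).contDiffAt
    exact ContDiffAt.comp (g := u i) x ((hu i).contDiffAt (hopen.mem_nhds (hmem x))) h1
  have hderiv : ∀ x : ℝ, ‖deriv (fun x : ℝ => u i (s + x * Complex.I)) x‖ₑ ≤
      ‖fderiv ℝ (u i) (s + x * Complex.I)‖ₑ := by
    intro x
    have hd : DifferentiableAt ℝ (u i) (s + x * Complex.I) :=
      ((hu i).contDiffAt (hopen.mem_nhds (hmem x))).differentiableAt (by simp)
    have h1 : HasDerivAt (fun x : ℝ => u i (s + x * Complex.I))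
        (fderiv ℝ (u i) (s + x * Complex.I) Complex.I) x :=
      hd.hasFDerivAt.comp_hasDerivAt x (hline x)
    rw [h1.deriv, enorm_le_iff_norm_le]
    simpa using (fderiv ℝ (u i) (s + x * Complex.I)).le_opNorm Complex.I
  have hosc := enorm_sub_le_of_lintegral_enorm_deriv_sq hC.contDiffOn ht ht' hη
  have hint : ∫⁻ x in Set.Ioc (-Real.pi) Real.pi,
      ‖deriv (fun x : ℝ => u i (s + x * Complex.I)) x‖ₑ ^ 2 ≤ η * ENNReal.ofReal (ε / 2) := by
    refine le_trans (lintegral_mono fun x => ?_) hs.le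
    refine le_trans (pow_le_pow_left' (hderiv x) 2) ?_
    exact Finset.single_le_sum (f := fun i => ‖fderiv ℝ (u i) (s + x * Complex.I)‖ₑ ^ 2)
      (fun _ _ => zero_le) (Finset.mem_univ i)
  have hfinal : ‖u i (s + t * Complex.I) - u i (s + t' * Complex.I)‖ₑ ≤ ENNReal.ofReal ε := by
    calc _ ≤ _ := hosc
      _ ≤ η * ENNReal.ofReal (Real.pi - -Real.pi) +
          (η : ENNReal)⁻¹ * (η * ENNReal.ofReal (ε / 2)) := by gcongr
      _ = ENNReal.ofReal (ε / (4 * Real.pi)) * ENNReal.ofReal (Real.pi - -Real.pi) +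
          ENNReal.ofReal (ε / 2) := by
        rw [← mul_assoc, ENNReal.inv_mul_cancel (by simpa using hη) ENNReal.coe_ne_top, one_mul]
        rfl
      _ = ENNReal.ofReal ε := by
        rw [← ENNReal.ofReal_mul hη0.le, ← ENNReal.ofReal_add
          (mul_nonneg hη0.le (by linarith)) (by positivity)]
        congr 1
        field_simp
        ring
  rwa [← ofReal_norm, ENNReal.ofReal_le_ofReal_iff hε.le] at hfinal

/-! ### Dirichlet integrals of bump functions along an injective holomorphic map -/

theorem abs_det_smul_one_complex (c : ℂ) :
    ENNReal.ofReal |(c • (1 : ℂ →L[ℝ] ℂ)).det| = ‖c‖ₑ ^ 2 := by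
  have h : ((c • (1 : ℂ →L[ℝ] ℂ) : ℂ →L[ℝ] ℂ) : ℂ →ₗ[ℝ] ℂ) =
      ((c • (LinearMap.id : ℂ →ₗ[ℂ] ℂ)).restrictScalars ℝ) := by
    ext
    simp
  rw [ContinuousLinearMap.det, h, LinearMap.det_restrictScalars]
  simp [Algebra.norm_complex_apply, Complex.normSq_eq_norm_sq, ENNReal.ofReal_pow]

section

variable {M : Type*} [TopologicalSpace M] [ChartedSpace ℂ M]

/-- The extension by zero to the whole surface of a function given in the chart at `p`. -/
noncomputable def chartExtend {E : Type*} [Zero E] (p : M) (B : ℂ → E) : M → E :=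
  (chartAt ℂ p).source.indicator (B ∘ chartAt ℂ p)

theorem chartExtend_of_mem {E : Type*} [Zero E] {p y : M} {B : ℂ → E}
    (hy : y ∈ (chartAt ℂ p).source) :
    chartExtend p B y = B (chartAt ℂ p y) :=
  Set.indicator_of_mem hy _

theorem chartExtend_comp_eventuallyEq {E : Type*} [Zero E] {h : ℂ → M} {w : ℂ}
    (hh : ContinuousAt h w) {p : M} (B : ℂ → E) (hw : h w ∈ (chartAt ℂ p).source) :
    chartExtend p B ∘ h =ᶠ[𝓝 w] B ∘ chartAt ℂ p ∘ h := by
  filter_upwards [hh ((chartAt ℂ p).open_source.mem_nhds hw)] with x hx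
  exact chartExtend_of_mem hx

/-- Where the chart of `p` is not defined, an extension by zero of a function supported in a compact
subset of the chart vanishes identically nearby. -/
theorem chartExtend_eventually_eq_zero {E : Type*} [Zero E] [T2Space M] {p y : M}
    {B : ℂ → E} {K : Set ℂ}
    (hK : IsCompact K) (hKt : K ⊆ (chartAt ℂ p).target) (hB : ∀ z ∉ K, B z = 0)
    (hy : y ∉ (chartAt ℂ p).symm '' K) : ∀ᶠ x in 𝓝 y, chartExtend p B x = 0 := by
  have hc : IsClosed ((chartAt ℂ p).symm '' K) :=
    (hK.image_of_continuousOn ((chartAt ℂ p).continuousOn_symm.mono hKt)).isClosed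
  filter_upwards [hc.isOpen_compl.mem_nhds hy] with x hx
  by_cases hxs : x ∈ (chartAt ℂ p).source
  · rw [chartExtend_of_mem hxs]
    exact hB _ fun hk => hx ⟨_, hk, (chartAt ℂ p).left_inv hxs⟩
  · exact Set.indicator_of_notMem hxs _

theorem continuous_chartExtend {E : Type*} [NormedAddCommGroup E] [T2Space M] {p : M}
    {B : ℂ → E} {K : Set ℂ} (hBc : Continuous B)
    (hK : IsCompact K) (hKt : K ⊆ (chartAt ℂ p).target) (hB : ∀ z ∉ K, B z = 0) :
    Continuous (chartExtend p B) := by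
  rw [continuous_iff_continuousAt]
  intro y
  by_cases hy : y ∈ (chartAt ℂ p).source
  · refine (hBc.continuousAt.comp ((chartAt ℂ p).continuousAt hy)).congr ?_
    filter_upwards [(chartAt ℂ p).open_source.mem_nhds hy] with x hx
    exact (chartExtend_of_mem hx).symm
  · have hy' : y ∉ (chartAt ℂ p).symm '' K := by
      rintro ⟨z, hz, rfl⟩
      exact hy ((chartAt ℂ p).map_target (hKt hz))
    exact (continuousAt_const (y := (0 : E))).congr
      ((chartExtend_eventually_eq_zero hK hKt hB hy').mono fun x hx => hx.symm)

variable {E : Type*} [NormedAddCommGroup E] [NormedSpace ℝ E]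

variable [IsManifold 𝓘(ℂ) ω M]

theorem ContMDiffAt.contDiffAt_chart_comp {h : ℂ → M} {w : ℂ}
    (hh : ContMDiffAt 𝓘(ℂ) 𝓘(ℂ) ω h w) {p : M} (hw : h w ∈ (chartAt ℂ p).source) :
    ContDiffAt ℂ ω (chartAt ℂ p ∘ h) w :=
  ((contMDiffOn_chart.contMDiffAt ((chartAt ℂ p).open_source.mem_nhds hw)).comp w hh).contDiffAt

theorem contDiffAt_chartExtend_comp [T2Space M] {h : ℂ → M} {w : ℂ}
    (hh : ContMDiffAt 𝓘(ℂ) 𝓘(ℂ) ω h w) {p : M} {B : ℂ → E} {K : Set ℂ} (hBc : ContDiff ℝ 1 B)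
    (hK : IsCompact K) (hKt : K ⊆ (chartAt ℂ p).target) (hB : ∀ z ∉ K, B z = 0) :
    ContDiffAt ℝ 1 (chartExtend p B ∘ h) w := by
  by_cases hw : h w ∈ (chartAt ℂ p).source
  · refine ContDiffAt.congr_of_eventuallyEq ?_
      (chartExtend_comp_eventuallyEq hh.continuousAt B hw)
    have h1 : ContDiffAt ℝ 1 (chartAt ℂ p ∘ h) w :=
      ((hh.contDiffAt_chart_comp hw).restrict_scalars ℝ).of_le le_top
    exact hBc.contDiffAt.comp w h1
  · have hw' : h w ∉ (chartAt ℂ p).symm '' K := by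
      rintro ⟨z, hz, hzw⟩
      exact hw (hzw ▸ (chartAt ℂ p).map_target (hKt hz))
    refine (contDiffAt_const (c := (0 : E))).congr_of_eventuallyEq ?_
    exact hh.continuousAt.eventually (chartExtend_eventually_eq_zero hK hKt hB hw')

open MeasureTheory in
/-- The Dirichlet integral is finite: up to the maximum of `‖dB‖²`, it is at most the
area of the image in the chart, which lies in the compact support of `B`. -/
theorem lintegral_enorm_fderiv_chartExtend_comp_ne_top [T2Space M] {h : ℂ → M} {O S : Set ℂ}
    (hO : IsOpen O) (hS : MeasurableSet S) (hSO : S ⊆ O)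
    (hh : ∀ w ∈ O, ContMDiffAt 𝓘(ℂ) 𝓘(ℂ) ω h w) (hinj : Set.InjOn h S) {p : M} {B : ℂ → E}
    {K : Set ℂ} (hBc : ContDiff ℝ 1 B) (hK : IsCompact K) (hKt : K ⊆ (chartAt ℂ p).target)
    (hB : ∀ z ∉ K, B z = 0) :
    ∫⁻ w in S, ‖fderiv ℝ (chartExtend p B ∘ h) w‖ₑ ^ 2 ≠ ⊤ := by
  set φ := chartAt ℂ p
  have hcl : IsClosed (φ.symm '' K) :=
    (hK.image_of_continuousOn (φ.continuousOn_symm.mono hKt)).isClosed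
  have hcO : ContinuousOn h O := fun w hw => (hh w hw).continuousAt.continuousWithinAt
  set A : Set ℂ := S ∩ h ⁻¹' (φ.symm '' K)
  have hA : MeasurableSet A := by
    have h1 : IsOpen (O ∩ h ⁻¹' (φ.symm '' K)ᶜ) := hcO.isOpen_inter_preimage hO hcl.isOpen_compl
    have h2 : A = S \ (O ∩ h ⁻¹' (φ.symm '' K)ᶜ) := by
      ext w
      constructor
      · rintro ⟨hw, hwK⟩
        exact ⟨hw, fun hc => hc.2 hwK⟩
      · rintro ⟨hw, hwK⟩
        exact ⟨hw, by_contra fun hc => hwK ⟨hSO hw, hc⟩⟩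
    rw [h2]
    exact hS.diff h1.measurableSet
  have hAs : ∀ w ∈ A, h w ∈ φ.source := by
    rintro w ⟨-, z, hz, hzw⟩
    exact hzw ▸ φ.map_target (hKt hz)
  have hAd : ∀ w ∈ A, DifferentiableAt ℂ (φ ∘ h) w := fun w hw =>
    ((hh w (hSO hw.1)).contDiffAt_chart_comp (hAs w hw)).differentiableAt (by simp)
  have harea : ∫⁻ w in A, ‖deriv (φ ∘ h) w‖ₑ ^ 2 ≤ volume K := by
    have h1 := lintegral_image_eq_lintegral_abs_det_fderiv_mul volume hA
      (fun w hw => ((hAd w hw).hasDerivAt.complexToReal_fderiv).hasFDerivWithinAt)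
      (fun w hw w' hw' hww => hinj hw.1 hw'.1 (φ.injOn (hAs w hw) (hAs w' hw') hww))
      (fun _ => 1)
    simp only [abs_det_smul_one_complex, mul_one] at h1
    rw [← h1, setLIntegral_one]
    refine measure_mono ?_
    rintro _ ⟨w, ⟨-, z, hz, hzw⟩, rfl⟩
    rw [Function.comp_apply, ← hzw, φ.right_inv (hKt hz)]
    exact hz
  obtain ⟨C, hC⟩ := hK.exists_bound_of_continuousOn
    (hBc.continuous_fderiv (by simp)).continuousOn
  have hle : ∀ w ∈ S, ‖fderiv ℝ (chartExtend p B ∘ h) w‖ₑ ^ 2 ≤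
      A.indicator (fun w => ENNReal.ofReal C ^ 2 * ‖deriv (φ ∘ h) w‖ₑ ^ 2) w := by
    intro w hw
    by_cases hwA : w ∈ A
    · rw [Set.indicator_of_mem hwA, ← mul_pow]
      refine pow_le_pow_left' ?_ 2
      have hBd : DifferentiableAt ℝ B ((φ ∘ h) w) := (hBc.differentiable (by simp)) _
      have hd := hBd.hasFDerivAt.comp w (hAd w hwA).hasDerivAt.complexToReal_fderiv
      rw [(chartExtend_comp_eventuallyEq (hh w (hSO hw)).continuousAt B (hAs w hwA)).fderiv_eq,
        hd.fderiv]
      have hwK : (φ ∘ h) w ∈ K := by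
        obtain ⟨-, z, hz, hzw⟩ := hwA
        rw [Function.comp_apply, ← hzw, φ.right_inv (hKt hz)]
        exact hz
      have hC0 : 0 ≤ C := (norm_nonneg _).trans (hC _ hwK)
      rw [← ofReal_norm, ← ofReal_norm, ← ENNReal.ofReal_mul hC0]
      refine ENNReal.ofReal_le_ofReal ?_
      refine (ContinuousLinearMap.opNorm_comp_le _ _).trans ?_
      refine mul_le_mul (hC _ hwK) ?_ (norm_nonneg _) hC0
      refine (norm_smul_le _ _).trans ?_
      exact mul_le_of_le_one_right (norm_nonneg _) ContinuousLinearMap.norm_id_le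
    · have h0 : chartExtend p B ∘ h =ᶠ[𝓝 w] fun _ => (0 : E) :=
        (hh w (hSO hw)).continuousAt.eventually
          (chartExtend_eventually_eq_zero hK hKt hB fun hc => hwA ⟨hw, hc⟩)
      have h1 : fderiv ℝ (chartExtend p B ∘ h) w = 0 := by
        rw [h0.fderiv_eq]
        exact fderiv_const_apply _
      rw [h1, ← ofReal_norm, norm_zero, ENNReal.ofReal_zero, zero_pow two_ne_zero]
      exact zero_le
  refine ne_top_of_le_ne_top ?_ (setLIntegral_mono' hS hle)
  rw [setLIntegral_indicator hA, Set.inter_eq_left.2 Set.inter_subset_left,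
    lintegral_const_mul' _ _ (by simp)]
  exact ENNReal.mul_ne_top (by simp) (ne_top_of_le_ne_top hK.measure_lt_top.ne harea)

/-- A cut-off coordinate `z ↦ (β z, β z • z)` in which `β` is a bump function. -/
noncomputable def bumpCoord {c : ℂ} (β : ContDiffBump c) (z : ℂ) : ℝ × ℂ := (β z, β z • z)

theorem contDiff_bumpCoord {c : ℂ} (β : ContDiffBump c) : ContDiff ℝ 1 (bumpCoord β) :=
  β.contDiff.prodMk (β.contDiff.smul contDiff_id)

theorem bumpCoord_eq_zero {c : ℂ} (β : ContDiffBump c) {z : ℂ}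
    (hz : z ∉ Metric.closedBall c β.rOut) : bumpCoord β z = 0 := by
  have : β z = 0 := β.zero_of_le_dist (le_of_lt (by simpa using hz))
  simp [bumpCoord, this]

/-- A compact surface has finitely many cut-off coordinates that together separate its points. -/
theorem exists_finite_bumpCoord_injective (M : Type*) [TopologicalSpace M] [ChartedSpace ℂ M]
    [CompactSpace M] : ∃ (β : ∀ p : M, ContDiffBump (chartAt ℂ p p)) (T : Finset M),
      (∀ p, Metric.closedBall (chartAt ℂ p p) (β p).rOut ⊆ (chartAt ℂ p).target) ∧
      Function.Injective fun (y : M) (p : T) => chartExtend (p : M) (bumpCoord (β p)) y := by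
  have h1 : ∀ p : M, ∃ β : ContDiffBump (chartAt ℂ p p),
      Metric.closedBall (chartAt ℂ p p) β.rOut ⊆ (chartAt ℂ p).target := by
    intro p
    obtain ⟨r, hr, hsub⟩ := Metric.nhds_basis_closedBall.mem_iff.1
      ((chartAt ℂ p).open_target.mem_nhds (mem_chart_target ℂ p))
    exact ⟨⟨r / 2, r, by positivity, by linarith⟩, hsub⟩
  choose β hβ using h1
  have hN : ∀ p : M, (chartAt ℂ p).source ∩
      chartAt ℂ p ⁻¹' Metric.ball (chartAt ℂ p p) (β p).rIn ∈ 𝓝 p := fun p =>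
    inter_mem ((chartAt ℂ p).open_source.mem_nhds (mem_chart_source ℂ p))
      ((chartAt ℂ p).continuousAt (mem_chart_source ℂ p)
        (Metric.ball_mem_nhds _ (β p).rIn_pos))
  obtain ⟨T, -, hT⟩ := isCompact_univ.elim_nhds_subcover _ fun p _ => hN p
  refine ⟨β, T, hβ, fun y y' hyy => ?_⟩
  obtain ⟨p, hpT, hys, hyb⟩ := Set.mem_iUnion₂.1 (hT (Set.mem_univ y))
  have h2 : chartExtend p (bumpCoord (β p)) y = chartExtend p (bumpCoord (β p)) y' :=
    congrFun hyy ⟨p, hpT⟩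
  have hβy : β p (chartAt ℂ p y) = 1 :=
    (β p).one_of_mem_closedBall (Metric.ball_subset_closedBall hyb)
  rw [chartExtend_of_mem hys] at h2
  by_cases hys' : y' ∈ (chartAt ℂ p).source
  · rw [chartExtend_of_mem hys'] at h2
    simp only [bumpCoord, hβy, Prod.mk.injEq] at h2
    rw [← h2.1, one_smul, one_smul] at h2
    exact (chartAt ℂ p).injOn hys hys' h2.2
  · have h3 : chartExtend p (bumpCoord (β p)) y' = 0 := Set.indicator_of_notMem hys' _
    rw [h3] at h2
    simpa [bumpCoord, hβy] using congrArg Prod.fst h2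

end

/-! ### Isolated singularities of injective holomorphic maps into a compact surface -/

section

variable {M : Type*} [TopologicalSpace M] [T2Space M] [ChartedSpace ℂ M]

theorem exp_mem_puncturedBall {w : ℂ} (hw : w.re < 0) :
    Complex.exp w ∈ Metric.ball (0 : ℂ) 1 \ {0} := by
  refine ⟨?_, Complex.exp_ne_zero w⟩
  rw [mem_ball_zero_iff, Complex.norm_exp]
  exact Real.exp_lt_one_iff.2 hw

/-- An injective holomorphic map of the punctured disc into a compact surface sends arbitrarily
small circles about the puncture into any given neighbourhood of a suitable point `q`. Here the
circle of radius `exp s` is parametrised by `t ↦ exp (s + t * I)`. -/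
theorem exists_point_small_circles [CompactSpace M] [IsManifold 𝓘(ℂ) ω M] {f : ℂ → M}
    (hf : ∀ z ∈ Metric.ball (0 : ℂ) 1 \ {0}, ContMDiffAt 𝓘(ℂ) 𝓘(ℂ) ω f z)
    (hinj : Set.InjOn f (Metric.ball (0 : ℂ) 1 \ {0})) :
    ∃ q : M, ∀ V ∈ 𝓝 q, ∀ R : ℝ, ∃ s < R, s < 0 ∧
      ∀ t ∈ Set.Icc (-Real.pi) Real.pi, f (Complex.exp (s + t * Complex.I)) ∈ V := by
  set h : ℂ → M := f ∘ Complex.exp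
  set O : Set ℂ := {w | w.re < 0}
  have hO : IsOpen O := isOpen_lt Complex.continuous_re continuous_const
  have hh : ∀ w ∈ O, ContMDiffAt 𝓘(ℂ) 𝓘(ℂ) ω h w := fun w hw =>
    (hf _ (exp_mem_puncturedBall hw)).comp w Complex.contDiff_exp.contDiffAt.contMDiffAt
  have hhinj : Set.InjOn h logStrip := fun w hw w' hw' hww =>
    Complex.exp_inj_of_neg_pi_lt_of_le_pi hw.2.1 hw.2.2 hw'.2.1 hw'.2.2
      (hinj (exp_mem_puncturedBall hw.1) (exp_mem_puncturedBall hw'.1) hww)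
  obtain ⟨β, T, hβ, hTinj⟩ := exists_finite_bumpCoord_injective M
  have hβc : ∀ p : M, IsCompact (Metric.closedBall (chartAt ℂ p p) (β p).rOut) :=
    fun p => isCompact_closedBall _ _
  have hβ0 : ∀ p : M, ∀ z ∉ Metric.closedBall (chartAt ℂ p p) (β p).rOut,
    bumpCoord (β p) z = 0 := fun p z hz => bumpCoord_eq_zero (β p) hz
  set G : M → T → ℝ × ℂ := fun y p => chartExtend (p : M) (bumpCoord (β p)) y
  have hG : Continuous G := continuous_pi fun p =>
    continuous_chartExtend (contDiff_bumpCoord (β p)).continuous (hβc p) (hβ p) (hβ0 p)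
  have hosc : ∀ n : ℕ, ∃ s < -(n : ℝ), ∀ p : T, ∀ t ∈ Set.Icc (-Real.pi) Real.pi,
      ∀ t' ∈ Set.Icc (-Real.pi) Real.pi, ‖G (h (s + t * Complex.I)) p -
        G (h (s + t' * Complex.I)) p‖ ≤ 1 / ((n : ℝ) + 1) := fun n =>
    exists_segment_oscillation_le (u := fun (p : T) => chartExtend (p : M) (bumpCoord (β p)) ∘ h)
      (fun p w hw => (contDiffAt_chartExtend_comp (hh w hw) (contDiff_bumpCoord (β p)) (hβc p)
        (hβ p) (hβ0 p)).contDiffWithinAt)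
      (fun p => lintegral_enorm_fderiv_chartExtend_comp_ne_top hO measurableSet_logStrip
        (fun w hw => hw.1) hh hhinj (contDiff_bumpCoord (β p)) (hβc p) (hβ p) (hβ0 p))
      Nat.one_div_pos_of_nat (by simp)
  choose s hs hsosc using hosc
  obtain ⟨q, hq⟩ := exists_clusterPt_of_compactSpace (map (fun n => h (s n)) atTop)
  refine ⟨q, fun V hV R => ?_⟩
  rw [(hG.isClosedEmbedding hTinj).isInducing.nhds_eq_comap] at hV
  obtain ⟨ε, hε, hεV⟩ := (Metric.nhds_basis_ball.comap G).mem_iff.1 hV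
  have hfreq : ∃ᶠ n in atTop, G (h (s n)) ∈ Metric.ball (G q) (ε / 2) :=
    mapClusterPt_iff_frequently.1 hq _
      (hG.continuousAt.preimage_mem_nhds (Metric.ball_mem_nhds _ (half_pos hε)))
  have hlarge : ∀ᶠ n : ℕ in atTop, 1 / ((n : ℝ) + 1) < ε / 2 ∧ -R ≤ n :=
    (tendsto_one_div_add_atTop_nhds_zero_nat.eventually_lt_const (half_pos hε)).and
      (tendsto_natCast_atTop_atTop.eventually_ge_atTop (-R))
  obtain ⟨n, hn1, hn2, hn3⟩ := (hfreq.and_eventually hlarge).exists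
  have hn0 : (0 : ℝ) ≤ n := n.cast_nonneg
  refine ⟨s n, by linarith [hs n], by linarith [hs n], fun t ht => hεV ?_⟩
  have hpi := Real.pi_pos
  rw [Set.mem_preimage, Metric.mem_ball, dist_pi_lt_iff hε]
  intro p
  have h1 := hsosc n p t ht 0 ⟨by linarith, hpi.le⟩
  have h2 : dist (G (h (s n)) p) (G q p) < ε / 2 := (dist_le_pi_dist _ _ p).trans_lt hn1
  rw [← dist_eq_norm] at h1
  simp only [Complex.ofReal_zero, zero_mul, add_zero] at h1
  calc dist (G (h (s n + t * Complex.I)) p) (G q p) ≤ _ := dist_triangle _ (G (h (s n)) p) _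
    _ < ε := by linarith

theorem exists_exp_eq_of_norm {z : ℂ} (hz : z ≠ 0) : ∃ t ∈ Set.Icc (-Real.pi) Real.pi,
    z = Complex.exp (Real.log ‖z‖ + t * Complex.I) := by
  refine ⟨z.arg, ⟨(Complex.neg_pi_lt_arg z).le, Complex.arg_le_pi z⟩, ?_⟩
  have h := Complex.exp_log hz
  rw [Complex.log] at h
  exact h.symm

/-- The topological half of the extension theorem. Let `W` be a small chart disc about `q`. The
image of the closed annulus between two circles that are mapped close to `q` is connected and,
by openness, its frontier is close to `q`. So it either contains the circle `∂W` or misses it. In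
the first case its union with `W` is open and closed, hence is all of the surface, which
contradicts injectivity; so the image is contained in `W`. -/
theorem tendsto_of_small_circles [ConnectedSpace M] {f : ℂ → M}
    (hf : ContinuousOn f (Metric.ball (0 : ℂ) 1 \ {0}))
    (hinj : Set.InjOn f (Metric.ball (0 : ℂ) 1 \ {0}))
    (hopen : ∀ A ⊆ Metric.ball (0 : ℂ) 1 \ {0}, IsOpen A → IsOpen (f '' A)) {q : M}
    (hq : ∀ V ∈ 𝓝 q, ∀ R : ℝ, ∃ s < R, s < 0 ∧
      ∀ t ∈ Set.Icc (-Real.pi) Real.pi, f (Complex.exp (s + t * Complex.I)) ∈ V) :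
    Tendsto f (𝓝[≠] 0) (𝓝 q) := by
  -- a point `z₀` of the punctured disc that is not mapped to `q`
  obtain ⟨z₀, hz₀, hz₀q⟩ : ∃ z₀ ∈ Metric.ball (0 : ℂ) 1 \ {0}, f z₀ ≠ q := by
    by_contra! hcon
    have ha : (1 / 2 : ℂ) ∈ Metric.ball (0 : ℂ) 1 \ {0} := by norm_num
    have hb : (1 / 3 : ℂ) ∈ Metric.ball (0 : ℂ) 1 \ {0} := by norm_num
    have := hinj ha hb ((hcon _ ha).trans (hcon _ hb).symm)
    norm_num at this
  intro N hN
  set φ := chartAt ℂ q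
  have hqs : q ∈ φ.source := mem_chart_source ℂ q
  have hN' : φ.target ∩ φ.symm ⁻¹' (N ∩ {f z₀}ᶜ) ∈ 𝓝 (φ q) :=
    inter_mem (φ.open_target.mem_nhds (mem_chart_target ℂ q))
      (φ.tendsto_symm hqs (inter_mem hN (isOpen_ne.mem_nhds hz₀q.symm)))
  obtain ⟨r, hr, hrN⟩ := Metric.nhds_basis_closedBall.mem_iff.1 hN'
  have hopenBall : ∀ r' ≤ r, IsOpen (φ.symm '' Metric.ball (φ q) r') := fun r' hr' =>
    φ.symm.isOpen_image_of_subset_source Metric.isOpen_ball fun z hz =>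
      (hrN (Metric.closedBall_subset_closedBall hr' (Metric.ball_subset_closedBall hz))).1
  have hcs : ContinuousOn φ.symm (Metric.closedBall (φ q) r) :=
    φ.continuousOn_symm.mono fun z hz => (hrN hz).1
  set W : Set M := φ.symm '' Metric.ball (φ q) r
  set V : Set M := φ.symm '' Metric.ball (φ q) (r / 2)
  set Γ : Set M := φ.symm '' Metric.sphere (φ q) r
  have hVW : V ⊆ W := Set.image_mono (Metric.ball_subset_ball (by linarith))
  have hW : IsOpen W := hopenBall r le_rfl
  have hVmem : V ∈ 𝓝 q := (hopenBall (r / 2) (by linarith)).mem_nhds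
    ⟨φ q, Metric.mem_ball_self (by linarith), φ.left_inv hqs⟩
  have hWN : W ⊆ N ∩ {f z₀}ᶜ := by
    rintro _ ⟨z, hz, rfl⟩
    exact (hrN (Metric.ball_subset_closedBall hz)).2
  have hclW : closure W ⊆ W ∪ Γ := by
    rw [← Set.image_union, Metric.ball_union_sphere]
    exact closure_minimal (Set.image_mono Metric.ball_subset_closedBall)
      ((isCompact_closedBall _ _).image_of_continuousOn hcs).isClosed
  have hΓ : IsPreconnected Γ :=
    ((isConnected_sphere (by simp) (φ q) hr.le).image _
      (hcs.mono Metric.sphere_subset_closedBall)).isPreconnected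
  have hΓV : Disjoint Γ V := by
    rw [Set.disjoint_left]
    rintro _ ⟨z, hz, rfl⟩ ⟨z', hz', hzz⟩
    have hz't : z' ∈ φ.symm.source := (hrN (Metric.mem_closedBall.2
      ((Metric.mem_ball.1 hz').le.trans (by linarith)))).1
    have := φ.symm.injOn hz't (hrN (Metric.sphere_subset_closedBall hz)).1 hzz
    rw [this, Metric.mem_ball, Metric.mem_sphere.1 hz] at hz'
    linarith
  obtain ⟨s₁, hs₁, hs₁0, hs₁V⟩ := hq V hVmem (Real.log ‖z₀‖)
  -- the punctured disc of radius `exp s₁` is mapped into `W`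
  suffices hmain : ∀ z : ℂ, z ≠ 0 → ‖z‖ < Real.exp s₁ → f z ∈ W by
    have h1 : Metric.ball (0 : ℂ) (Real.exp s₁) ∈ 𝓝 (0 : ℂ) :=
      Metric.ball_mem_nhds _ (Real.exp_pos _)
    change ∀ᶠ z in 𝓝[≠] 0, f z ∈ N
    filter_upwards [mem_nhdsWithin_of_mem_nhds h1, self_mem_nhdsWithin] with z hz hz0
    exact (hWN (hmain z hz0 (mem_ball_zero_iff.1 hz))).1
  intro z hz0 hz
  have hzlog : Real.log ‖z‖ < s₁ := (Real.log_lt_iff_lt_exp (norm_pos_iff.2 hz0)).2 hz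
  obtain ⟨s₂, hs₂, -, hs₂V⟩ := hq V hVmem (Real.log ‖z‖)
  have hpi := Real.pi_pos
  -- `Q` is the logarithm of a closed annulus that contains `z`, and `A` is the open annulus
  set Q : Set ℂ := Set.Icc s₂ s₁ ×ℂ Set.Icc (-Real.pi) Real.pi
  set A : Set ℂ := {y | ‖y‖ ∈ Set.Ioo (Real.exp s₂) (Real.exp s₁)}
  have hQ0 : ∀ w ∈ Q, w.re < 0 := fun w hw => hw.1.2.trans_lt hs₁0
  have hexpQ : ∀ w ∈ Q, Complex.exp w ∈ Metric.ball (0 : ℂ) 1 \ {0} := fun w hw =>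
    exp_mem_puncturedBall (hQ0 w hw)
  have hcQ : ContinuousOn (f ∘ Complex.exp) Q :=
    hf.comp Complex.continuous_exp.continuousOn hexpQ
  set Ibar : Set M := (f ∘ Complex.exp) '' Q
  have hIpre : IsPreconnected Ibar := by
    refine IsPreconnected.image ?_ _ hcQ
    exact (((convex_Icc s₂ s₁).linear_preimage Complex.reCLM.toLinearMap).inter
      ((convex_Icc (-Real.pi) Real.pi).linear_preimage Complex.imCLM.toLinearMap)).isPreconnected
  have hIclosed : IsClosed Ibar :=
    ((isCompact_Icc.reProdIm isCompact_Icc).image_of_continuousOn hcQ).isClosed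
  have hA : IsOpen A := isOpen_Ioo.preimage continuous_norm
  have hAD : A ⊆ Metric.ball (0 : ℂ) 1 \ {0} := by
    rintro y ⟨hy1, hy2⟩
    refine ⟨mem_ball_zero_iff.2 (hy2.trans (Real.exp_lt_one_iff.2 hs₁0)), ?_⟩
    rintro rfl
    rw [norm_zero] at hy1
    exact absurd hy1 (Real.exp_pos _).not_gt
  have hI : IsOpen (f '' A) := hopen A hAD hA
  have hAI : f '' A ⊆ Ibar := by
    rintro _ ⟨y, hy, rfl⟩
    have hy0 : y ≠ 0 := (hAD hy).2
    obtain ⟨t, ht, hyt⟩ := exists_exp_eq_of_norm hy0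
    refine ⟨Real.log ‖y‖ + t * Complex.I, ⟨?_, ?_⟩, by rw [Function.comp_apply, ← hyt]⟩
    · have hpos := norm_pos_iff.2 hy0
      simpa using And.intro ((Real.le_log_iff_exp_le hpos).2 hy.1.le)
        ((Real.log_le_iff_le_exp hpos).2 hy.2.le)
    · simpa using ht
  have hIA : Ibar ⊆ f '' A ∪ V := by
    rintro _ ⟨w, ⟨⟨hw1, hw2⟩, hwt⟩, rfl⟩
    have hw : (w.re + w.im * Complex.I : ℂ) = w := Complex.re_add_im w
    rcases hw1.eq_or_lt with h1 | h1
    · right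
      have := hs₂V w.im hwt
      rwa [h1, hw] at this
    rcases hw2.eq_or_lt with h2 | h2
    · right
      have := hs₁V w.im hwt
      rwa [← h2, hw] at this
    · left
      refine ⟨Complex.exp w, ?_, rfl⟩
      simp only [A, Set.mem_ofPred_eq, Complex.norm_exp]
      exact ⟨Real.exp_lt_exp.2 h1, Real.exp_lt_exp.2 h2⟩
  have hzI : f z ∈ Ibar := hAI ⟨z, ⟨(Real.lt_log_iff_exp_lt (norm_pos_iff.2 hz0)).1 hs₂, hz⟩, rfl⟩
  have hz₀I : f z₀ ∉ f '' A := by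
    rintro ⟨y, hy, hyz⟩
    have h1 : y = z₀ := hinj (hAD hy) hz₀ hyz
    have h2 := (Real.lt_log_iff_exp_lt (norm_pos_iff.2 hz₀.2)).1 hs₁
    rw [← h1] at h2
    exact absurd hy.2 h2.not_gt
  by_cases hΓI : (Γ ∩ f '' A).Nonempty
  · exfalso
    have hΓA : Γ ⊆ f '' A := by
      refine hΓ.subset_of_closure_inter_subset hI hΓI ?_
      rintro y ⟨hy, hyΓ⟩
      exact (hIA (closure_minimal hAI hIclosed hy)).resolve_right (Set.disjoint_left.1 hΓV hyΓ)
    have hclopen : IsClopen (f '' A ∪ W) := by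
      refine ⟨isClosed_of_closure_subset ?_, hI.union hW⟩
      rw [closure_union]
      rintro y (hy | hy)
      · exact (hIA (closure_minimal hAI hIclosed hy)).imp id (@hVW y)
      · exact (hclW hy).elim Or.inr fun h => Or.inl (hΓA h)
    have huniv := hclopen.eq_univ ⟨q, Or.inr (hVW (mem_of_mem_nhds hVmem))⟩
    rcases (huniv ▸ Set.mem_univ (f z₀) : f z₀ ∈ f '' A ∪ W) with h | h
    · exact hz₀I h
    · exact (hWN h).2 rfl
  · have hIW : Ibar ⊆ W := by
      refine hIpre.subset_of_closure_inter_subset hW ?_ ?_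
      · refine ⟨f (Complex.exp (s₁ + (0 : ℝ) * Complex.I)), ⟨_, ⟨?_, ?_⟩, rfl⟩,
          hVW (hs₁V 0 ⟨by linarith, hpi.le⟩)⟩
        · simpa using (hs₂.trans hzlog).le
        · simpa using hpi.le
      · rintro y ⟨hy, hyI⟩
        refine (hclW hy).resolve_right fun hyΓ => ?_
        rcases hIA hyI with h | h
        · exact hΓI ⟨y, hyΓ, h⟩
        · exact Set.disjoint_left.1 hΓV hyΓ h
    exact hIW hzI

/-- An isolated singularity of an injective holomorphic map into a compact connected Riemann
surface is removable. -/
theorem exists_tendsto_nhdsNE_zero_of_injOn [CompactSpace M] [ConnectedSpace M]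
    [IsManifold 𝓘(ℂ) ω M] {f : ℂ → M}
    (hf : ∀ z ∈ Metric.ball (0 : ℂ) 1 \ {0}, ContMDiffAt 𝓘(ℂ) 𝓘(ℂ) ω f z)
    (hinj : Set.InjOn f (Metric.ball (0 : ℂ) 1 \ {0}))
    (hopen : ∀ A ⊆ Metric.ball (0 : ℂ) 1 \ {0}, IsOpen A → IsOpen (f '' A)) :
    ∃ q : M, Tendsto f (𝓝[≠] 0) (𝓝 q) := by
  obtain ⟨q, hq⟩ := exists_point_small_circles hf hinj
  exact ⟨q, tendsto_of_small_circles (fun z hz => (hf z hz).continuousAt.continuousWithinAt)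
    hinj hopen hq⟩

end

/-! ### Extension over finitely many punctures -/

section

variable {X M : Type*} [TopologicalSpace X] [ChartedSpace ℂ X] [IsManifold 𝓘(ℂ) ω X]
  [TopologicalSpace M] [T2Space M] [CompactSpace M] [ConnectedSpace M] [ChartedSpace ℂ M]
  [IsManifold 𝓘(ℂ) ω M]

/-- The same in a chart at any point `p` of the source: a holomorphic map into a compact connected
surface that is injective and open off a finite set has a limit at `p`. -/
theorem exists_tendsto_nhdsNE_of_injOn_compl_finite [T1Space X] {F : X → M} {s : Set X}
    (hs : s.Finite) (hF : ∀ x ∉ s, ContMDiffAt 𝓘(ℂ) 𝓘(ℂ) ω F x) (hinj : Set.InjOn F sᶜ)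
    (hopen : ∀ A ⊆ sᶜ, IsOpen A → IsOpen (F '' A)) (p : X) :
    ∃ q : M, Tendsto F (𝓝[≠] p) (𝓝 q) := by
  set φ := chartAt ℂ p
  have hp : p ∈ φ.source := mem_chart_source ℂ p
  have hN : φ.target ∩ φ.symm ⁻¹' (s \ {p})ᶜ ∈ 𝓝 (φ p) :=
    inter_mem (φ.open_target.mem_nhds (mem_chart_target ℂ p))
      (φ.tendsto_symm hp (hs.sdiff.isClosed.isOpen_compl.mem_nhds (by simp)))
  obtain ⟨r, hr, hrN⟩ := Metric.nhds_basis_ball.mem_iff.1 hN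
  have hrC : (r : ℂ) ≠ 0 := by exact_mod_cast hr.ne'
  -- the parametrisation of a punctured disc about `p` by the punctured unit disc
  set a : ℂ → ℂ := fun z => φ p + r * z
  have ha : ∀ z ∈ Metric.ball (0 : ℂ) 1, a z ∈ Metric.ball (φ p) r := by
    intro z hz
    rw [mem_ball_zero_iff] at hz
    simpa [a, abs_of_pos hr] using mul_lt_of_lt_one_right hr hz
  have hat : ∀ z ∈ Metric.ball (0 : ℂ) 1, a z ∈ φ.target := fun z hz => (hrN (ha z hz)).1
  have has : ∀ z ∈ Metric.ball (0 : ℂ) 1 \ {0}, φ.symm (a z) ∈ sᶜ := by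
    rintro z ⟨hz, hz0⟩ hzs
    refine (hrN (ha z hz)).2 ⟨hzs, fun h => hz0 ?_⟩
    have h1 : a z = φ p := by rw [← (h : φ.symm (a z) = p), φ.right_inv (hat z hz)]
    simpa [a, hrC] using h1
  have hainj : Function.Injective a := fun z z' h => by simpa [a, hrC] using h
  have haopen : IsOpenMap a :=
    (isOpenMap_add_left (φ p)).comp (Homeomorph.mulLeft₀ (r : ℂ) hrC).isOpenMap
  obtain ⟨q, hq⟩ := exists_tendsto_nhdsNE_zero_of_injOn (f := F ∘ φ.symm ∘ a)
    (fun z hz => by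
      have h1 : ContMDiffAt 𝓘(ℂ) 𝓘(ℂ) ω a z :=
        (contDiffAt_const.add (contDiffAt_const.mul contDiffAt_id)).contMDiffAt
      have h2 : ContMDiffAt 𝓘(ℂ) 𝓘(ℂ) ω φ.symm (a z) :=
        contMDiffOn_chart_symm.contMDiffAt (φ.open_target.mem_nhds (hat z hz.1))
      exact (hF _ (has z hz)).comp z (h2.comp z h1))
    (fun z hz z' hz' h => hainj
      (φ.symm.injOn (hat z hz.1) (hat z' hz'.1) (hinj (has z hz) (has z' hz') h)))
    (fun A hA hAo => by
      rw [Set.image_comp, Set.image_comp]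
      refine hopen _ ?_ (φ.symm.isOpen_image_of_subset_source (haopen A hAo) ?_)
      · rintro _ ⟨_, ⟨z, hz, rfl⟩, rfl⟩
        exact has z (hA hz)
      · rintro _ ⟨z, hz, rfl⟩
        exact hat z (hA hz).1)
  refine ⟨q, ?_⟩
  have hsrc : ∀ᶠ x in 𝓝[≠] p, x ∈ φ.source :=
    mem_nhdsWithin_of_mem_nhds (φ.open_source.mem_nhds hp)
  have h1 : Tendsto (fun x => (φ x - φ p) / r) (𝓝[≠] p) (𝓝[≠] 0) := by
    refine tendsto_nhdsWithin_iff.2 ⟨?_, ?_⟩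
    · have h2 : ContinuousAt (fun x => (φ x - φ p) / r) p :=
        ((φ.continuousAt hp).sub continuousAt_const).div_const _
      have h3 : Tendsto (fun x => (φ x - φ p) / r) (𝓝 p) (𝓝 ((φ p - φ p) / r)) := h2
      rw [sub_self, zero_div] at h3
      exact h3.mono_left nhdsWithin_le_nhds
    · filter_upwards [hsrc, self_mem_nhdsWithin] with x hx hxp
      exact div_ne_zero (sub_ne_zero.2 fun h => hxp (φ.injOn hx hp h)) hrC
  refine (hq.comp h1).congr' ?_
  filter_upwards [hsrc] with x hx
  have h2 : a ((φ x - φ p) / r) = φ x := by simp only [a]; field_simp; ring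
  simp only [Function.comp_apply, h2, φ.left_inv hx]

/-- A biholomorphic map from a compact Riemann surface minus finitely many points onto an
open subset of a compact connected Riemann surface extends to a biholomorphic map of the compact
surfaces. -/
theorem Diffeomorph.exists_extension_of_finite_compl [CompactSpace X] [T2Space X]
    {V : TopologicalSpace.Opens X} (hV : ((V : Set X)ᶜ).Finite) [Nonempty X]
    {U : TopologicalSpace.Opens M} (j : Diffeomorph 𝓘(ℂ) 𝓘(ℂ) V U ω) :
    ∃ Ψ : Diffeomorph 𝓘(ℂ) 𝓘(ℂ) X M ω, ∀ x : V, Ψ x = j x := by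
  set F : X → M := Function.extend ((↑) : V → X) (fun x => (j x : M))
    fun _ => Classical.arbitrary M
  have hFj : ∀ x : V, F x = j x := fun x => Subtype.val_injective.extend_apply _ _ x
  have hjM : ContMDiff 𝓘(ℂ) 𝓘(ℂ) ω (fun x : V => (j x : M)) :=
    contMDiff_subtype_val.comp j.contMDiff
  have hFd : ∀ x ∈ V, ContMDiffAt 𝓘(ℂ) 𝓘(ℂ) ω F x := by
    intro x hx
    refine (contMDiffAt_subtype_iff (x := ⟨x, hx⟩)).1 ?_
    simpa only [hFj] using hjM ⟨x, hx⟩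
  have hFinj : Set.InjOn F V := by
    intro x hx y hy hxy
    have h1 : (j ⟨x, hx⟩ : M) = j ⟨y, hy⟩ := by rw [← hFj, ← hFj]; exact hxy
    exact congrArg Subtype.val (j.injective (Subtype.val_injective h1))
  have hFopen : ∀ A ⊆ (V : Set X), IsOpen A → IsOpen (F '' A) := by
    intro A hA hAo
    have h1 : F '' A = (↑) '' (j '' ((↑) ⁻¹' A)) := by
      ext y
      constructor
      · rintro ⟨x, hx, rfl⟩
        exact ⟨_, ⟨⟨x, hA hx⟩, hx, rfl⟩, (hFj _).symm⟩
      · rintro ⟨_, ⟨x, hx, rfl⟩, rfl⟩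
        exact ⟨x, hx, hFj x⟩
    rw [h1]
    exact U.isOpen.isOpenMap_subtype_val _
      (j.toHomeomorph.isOpenMap _ (hAo.preimage continuous_subtype_val))
  have hlim : ∀ x : X, ∃ y, Tendsto F (𝓝[V] x) (𝓝 y) := by
    intro x
    by_cases hx : x ∈ V
    · exact ⟨F x, (hFd x hx).continuousAt.tendsto.mono_left nhdsWithin_le_nhds⟩
    · obtain ⟨q, hq⟩ := exists_tendsto_nhdsNE_of_injOn_compl_finite hV
        (fun y hy => hFd y (by simpa using hy)) (by simpa using hFinj) (by simpa using hFopen) x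
      exact ⟨q, hq.mono_left (nhdsWithin_mono x fun y hy hyx => hx (hyx ▸ hy))⟩
  have hdense : Dense (V : Set X) := by
    have := nhdsNE_neBot_of_chartedSpace_complex (X := X)
    simpa [Set.sdiff_eq] using (dense_univ (X := X)).sdiff_finite hV
  set J : X → M := extendFrom V F
  have hJc : Continuous J := continuous_extendFrom hdense hlim
  have hJF : ∀ x ∈ V, J x = F x := extendFrom_extends
    fun x hx => (hFd x hx).continuousAt.continuousWithinAt
  have hJd : ContMDiff 𝓘(ℂ) 𝓘(ℂ) ω J := by
    refine contMDiff_of_continuous_of_finite_compl hJc hV fun x hx => ?_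
    have hx' : x ∈ V := by simpa using hx
    refine (hFd x hx').congr_of_eventuallyEq ?_
    filter_upwards [V.isOpen.mem_nhds hx'] with y hy using hJF y hy
  have hJb : Function.Bijective J := hJd.bijective_of_injOn_compl_finite hV (by
    rw [compl_compl]
    exact hFinj.congr fun x hx => (hJF x hx).symm)
  set e : X ≃ M := Equiv.ofBijective J hJb
  have hec : Continuous e.symm :=
    hJc.continuous_symm_of_equiv_compact_to_t2 (f := e)
  have hsymm : ∀ y : U, e.symm y = (j.symm y : X) := by
    intro y
    rw [Equiv.symm_apply_eq]
    change (y : M) = J (j.symm y)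
    rw [hJF _ (j.symm y).2, hFj, j.apply_symm_apply]
  have hed : ContMDiff 𝓘(ℂ) 𝓘(ℂ) ω e.symm := by
    refine contMDiff_of_continuous_of_finite_compl hec (hV.image J) fun y hy => ?_
    obtain ⟨x, rfl⟩ := hJb.2 y
    have hx : x ∈ V := by
      by_contra hx
      exact hy ⟨x, hx, rfl⟩
    have hyU : J x ∈ U := by
      rw [hJF x hx, hFj ⟨x, hx⟩]
      exact (j ⟨x, hx⟩).2
    refine (contMDiffAt_subtype_iff (x := ⟨J x, hyU⟩)).1 ?_
    have h1 : ContMDiff 𝓘(ℂ) 𝓘(ℂ) ω (fun y : U => (j.symm y : X)) :=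
      contMDiff_subtype_val.comp j.symm.contMDiff
    simpa only [hsymm] using h1 ⟨J x, hyU⟩
  exact ⟨⟨e, hJd, hed⟩, fun x => (hJF x x.2).trans (hFj x)⟩

end

theorem mainTheorem4 {M : Type*} [TopologicalSpace M] [T2Space M] [CompactSpace M]
    [ConnectedSpace M] [ChartedSpace ℂ M] [IsManifold 𝓘(ℂ) ω M]
    (U : TopologicalSpace.Opens M)
    (j : Diffeomorph 𝓘(ℂ) 𝓘(ℂ) thricePuncturedSphere U ω) :
    ∃ Φ : Diffeomorph 𝓘(ℂ) 𝓘(ℂ) M RiemannSphere ω,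
      ∀ p : thricePuncturedSphere, Φ (j p : M) = (p : RiemannSphere) := by
  have hfin : ((thricePuncturedSphere : Set RiemannSphere)ᶜ).Finite := by
    change (({((0 : ℂ) : RiemannSphere), ((1 : ℂ) : RiemannSphere), OnePoint.infty} :
      Set RiemannSphere)ᶜᶜ).Finite
    rw [compl_compl]
    exact Set.toFinite _
  obtain ⟨Ψ, hΨ⟩ := j.exists_extension_of_finite_compl hfin
  exact ⟨Ψ.symm, fun p => by rw [← hΨ p, Ψ.symm_apply_apply]⟩
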